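/- \textbf{Setting.} Fix $L, L_C, L_F, N, D, \lambda, \Lambda\in\mathbb N$ with $L_F, D,\lambda\ge 1$, $L-L_F+1\ge L_C+L_F$ and $\lambda\le\Lambda\le N\lambda$, and reals $\sigma, C>0$, $\eta\in\mathbb R$, $\theta_0\in\mathbb R^D$. A dataset $x=\{x_1,\dots,x_N\}$ consists of $N$ distinct sequences $x_n\in\mathbb R^L$, in a fixed order. Write $x\simeq x'$ if there is exactly one $n$ with $x_n\ne x'_n$, and $x_n,x'_n$ differ in exactly one time index ($1$-event-level neighbors). A model consists of a function $f_\theta$ with parameters $\theta\in\mathbb R^D$ that maps $\mathbb R^{L_C}$ to some prediction space, and a real-valued loss $\mathcal L$ comparing predictions with elements of $\mathbb R^{L_F}$, such that $\theta\mapsto\mathcal L(f_\theta(c),y)$ is differentiable for all $c\in\mathbb R^{L_C}$, $y\in\mathbb R^{L_F}$. \textbf{Epoch $M$} (deterministic top-level iteration, bottom-level Poisson sampling). Start with $\theta=\theta_0$. For $b=1,\dots,\lfloor N\lambda/\Lambda\rfloor$: the top-level batch consists of the $x_n$ with $1+(b-1)N'\le n\le bN'$, where $N'=\lfloor\Lambda/\lambda\rfloor$.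 For each such $n$ let $\bar x_n\in\mathbb R^{L_C+L}$ be $x_n$ with $L_C$ zeros prepended, and for each $t=1,\dots,L-L_F+1$ include the subsequence $\bar x_n[t:t+L_C+L_F-1]$ in the multiset $y$ independently with probability $r=\min\{1,\lambda/(L-L_F+1)\}$. Split each $y_i\in y$ into its first $L_C$ entries $y_{C,i}$ and last $L_F$ entries $y_{F,i}$, let $g_i=\nabla_\theta\mathcal L(f_\theta(y_{C,i}),y_{F,i})$ and $$\tilde g^{(b)}=\frac1\Lambda\Big(\sum_i \frac{g_i}{\max\{1,\|g_i\|_2/C\}}+Z_b\Big),\qquad Z_b\sim\mathcal N(0,\sigma^2C^2 I),$$ with fresh independent sampling and noise in each step, and update $\theta\leftarrow\theta-\eta\,\tilde g^{(b)}$. The mechanism releases the noisy gradients of all steps; $M_x$ denotes the joint law of $(\tilde g^{(b)})_b$ on input $x$. For probability distributions $P,Q$ and $\alpha\ge0$ let $H_\alpha(P\|Q)=\int\max\{\frac{dP}{dQ}-\alpha,0\}\,dQ$. The pair $(P,Q)$ is a \emph{dominating pair} of $M$ if $\sup_{x\simeq x'}H_\alpha(M_x\|M_{x'})\le H_\alpha(P\|Q)$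 for all $\alpha\ge 0$, and a \emph{tight dominating pair} if equality holds for all $\alpha\ge0$. \textbf{Theorem.} Let $$P(\lambda)=\sum_{i=1}^{L_C+L_F+1}p_i\,\mathcal N(-\mu_i,\sigma^2),\qquad Q(\lambda)=\sum_{i=1}^{L_C+L_F+1}p_i\,\mathcal N(\mu_i,\sigma^2),$$ where $\mu_i=i-1$ and $p_i=\binom{L_C+L_F}{i-1}r^{i-1}(1-r)^{L_C+L_F-i+1}$. Then $(P(\lambda),Q(\lambda))$ is a dominating pair of the epoch $M$ for every model, and it is tight: there is a model for which $(P(\lambda),Q(\lambda))$ is a tight dominating pair of $M$. -/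

import Mathlib

open MeasureTheory ProbabilityTheory
open scoped NNReal ENNReal

universe u

noncomputable section

/-! ### Hockey-stick divergence, dominating pairs, mixtures of Gaussians -/

/-- The hockey-stick divergence `H_α(P ‖ Q) = ∫ max {dP/dQ - α, 0} dQ`
(the subtraction of extended nonnegative reals is truncated at `0`). -/
def hockeyStick {Ω : Type*} [MeasurableSpace Ω] (α : ℝ≥0) (P Q : Measure Ω) : ℝ≥0∞ :=
  ∫⁻ o, (P.rnDeriv Q o - (α : ℝ≥0∞)) ∂Q

/-- `sup_{x ≃ x'} H_α(M_x ‖ M_{x'})`, where `M x` is the output distribution on input `x`. -/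
def privacyProfile {X Ω : Type*} [MeasurableSpace Ω] (nbr : X → X → Prop) (M : X → Measure Ω)
    (α : ℝ≥0) : ℝ≥0∞ :=
  ⨆ (x : X) (x' : X) (_ : nbr x x'), hockeyStick α (M x) (M x')

/-- `(P, Q)` is a dominating pair of distributions for the mechanism `M`. -/
def IsDominatingPair {X Ω Ω' : Type*} [MeasurableSpace Ω] [MeasurableSpace Ω']
    (nbr : X → X → Prop) (M : X → Measure Ω) (P Q : Measure Ω') : Prop :=
  IsProbabilityMeasure P ∧ IsProbabilityMeasure Q ∧
    ∀ α : ℝ≥0, privacyProfile nbr M α ≤ hockeyStick α P Q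

/-- `(P, Q)` is a tight dominating pair of distributions for the mechanism `M`. -/
def IsTightDominatingPair {X Ω Ω' : Type*} [MeasurableSpace Ω] [MeasurableSpace Ω']
    (nbr : X → X → Prop) (M : X → Measure Ω) (P Q : Measure Ω') : Prop :=
  IsProbabilityMeasure P ∧ IsProbabilityMeasure Q ∧
    ∀ α : ℝ≥0, privacyProfile nbr M α = hockeyStick α P Q

/-- The mixture of the univariate Gaussians with means `μ k`, standard deviation `σ` and
weights `p k`. -/
def MoG {K : ℕ} (μ p : Fin K → ℝ) (σ : ℝ≥0) : Measure ℝ :=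
  ∑ k, ENNReal.ofReal (p k) • gaussianReal (μ k) (σ ^ 2)

/-! ### Datasets of time series -/

/-- A dataset `{x_1, …, x_N}` of `N` distinct univariate time series of length `L`, in the order
in which they are iterated over (the indices are `0, …, N - 1`). -/
abbrev Dataset (N L : ℕ) : Type := Fin N ↪ (Fin L → ℝ)

/-- `w`-event-level neighbors: the datasets differ in exactly one pair of sequences, and these two
differ only in a range of indices of length `w`. -/
def EventNeighbor {N L : ℕ} (w : ℕ) (x x' : Dataset N L) : Prop :=
  ∃ n : Fin N, (∀ m, m ≠ n → x m = x' m) ∧ x n ≠ x' n ∧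
    ∃ t : Fin L, ∀ s : Fin L, x n s ≠ x' n s → (t : ℕ) ≤ s ∧ (s : ℕ) < t + w

/-! ### Subsampling -/

/-- The number `L - L_F + 1` of start indices of subsequences. -/
def numStarts (L LF : ℕ) : ℕ := L + 1 - LF

/-- The subsequence of length `L_C + L_F` that starts at the (0-based) position `t` of the sequence
`a` after `L_C` zeros have been prepended to it. -/
def subsequence (LC LF : ℕ) {L : ℕ} (a : Fin L → ℝ) (t : Fin (numStarts L LF)) :
    Fin (LC + LF) → ℝ :=
  fun i => Fin.append (fun _ : Fin LC => (0 : ℝ)) a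
    ⟨t + i, by have ht := t.isLt; have hi := i.isLt; unfold numStarts at ht; omega⟩

/-- The sampling rate `r = min {1, λ / (L - L_F + 1)}`. -/
def samplingRate (L LF lam : ℕ) : unitInterval :=
  ⟨min 1 ((lam : ℝ) / (numStarts L LF : ℝ)), le_min zero_le_one (by positivity), min_le_left _ _⟩

/-- Deterministic top-level iteration: the indices of the sequences that form the `b`-th batch
(`b = 0, 1, …`), i.e. the `b`-th block of `⌊Λ / λ⌋` consecutive indices. -/
def topLevelBatch (N lam Lam b : ℕ) : Finset (Fin N) :=
  Finset.univ.filter fun n => b * (Lam / lam) ≤ (n : ℕ) ∧ (n : ℕ) < (b + 1) * (Lam / lam)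

/-- The outcome of bottom-level sampling for one batch: for each sequence of the batch and each
start index, whether the corresponding subsequence is included. -/
abbrev SampleMask (N L LF lam Lam b : ℕ) : Type :=
  topLevelBatch N lam Lam b → Fin (numStarts L LF) → Bool

/-- Bottom-level Poisson sampling: each subsequence of each sequence of the batch is included
independently with probability `r`. -/
def poissonSampling (N L LF lam Lam b : ℕ) : Measure (SampleMask N L LF lam Lam b) :=
  Measure.pi fun _ => Measure.pi fun _ => bernoulliMeasure true false (samplingRate L LF lam)

/-! ### Noisy training -/

/-- A parametric forecasting model `f_θ` with parameters `θ ∈ ℝ^D` that maps a context window of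
length `L_C` to a prediction, with a loss that compares predictions to ground-truth forecast
windows of length `L_F`; the loss of `f_θ` is differentiable in `θ`. -/
structure ForecastModel (D LC LF : ℕ) where
  Pred : Type u
  predict : EuclideanSpace ℝ (Fin D) → (Fin LC → ℝ) → Pred
  loss : Pred → (Fin LF → ℝ) → ℝ
  differentiable_loss : ∀ (c : Fin LC → ℝ) (y : Fin LF → ℝ),
    Differentiable ℝ fun θ => loss (predict θ c) y

/-- The gradient `∇_θ ℒ(f_θ(y_C), y_F)` for the subsequence `y` with context window `y_C` (the first
`L_C` elements) and forecast window `y_F` (the last `L_F` elements). -/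
def ForecastModel.lossGradient {D LC LF : ℕ} (f : ForecastModel.{u} D LC LF)
    (θ : EuclideanSpace ℝ (Fin D)) (y : Fin (LC + LF) → ℝ) : EuclideanSpace ℝ (Fin D) :=
  gradient (fun θ' => f.loss (f.predict θ' fun i => y (Fin.castAdd LF i))
    fun i => y (Fin.natAdd LC i)) θ

/-- Gradient clipping `g / max {1, ‖g‖₂ / C}`. -/
def clip {D : ℕ} (C : ℝ) (g : EuclideanSpace ℝ (Fin D)) : EuclideanSpace ℝ (Fin D) :=
  (max 1 (‖g‖ / C))⁻¹ • g

section Training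

variable {L LC LF N D : ℕ} (lam Lam : ℕ) (σ : ℝ≥0) (C η : ℝ) (f : ForecastModel.{u} D LC LF)
  (x : Dataset N L)

/-- The sum of the clipped gradients over all sampled subsequences of the `b`-th batch. -/
def clippedGradientSum (b : ℕ) (θ : EuclideanSpace ℝ (Fin D))
    (m : SampleMask N L LF lam Lam b) : EuclideanSpace ℝ (Fin D) :=
  ∑ n : topLevelBatch N lam Lam b, ∑ t : Fin (numStarts L LF),
    if m n t = true then clip C (f.lossGradient θ (subsequence LC LF (x n) t)) else 0

/-- The law of the noisy gradient `g̃ = (ĝ + 𝒩(0, σ² C² I)) / Λ` of the training step on the `b`-th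
batch with current parameters `θ`. -/
def stepLaw (b : ℕ) (θ : EuclideanSpace ℝ (Fin D)) : Measure (EuclideanSpace ℝ (Fin D)) :=
  ((poissonSampling N L LF lam Lam b).prod (stdGaussian (EuclideanSpace ℝ (Fin D)))).map
    fun ω => (Lam : ℝ)⁻¹ • (clippedGradientSum lam Lam C f x b θ ω.1 + ((σ : ℝ) * C) • ω.2)

/-- The joint law of the noisy gradients of `k` successive training steps, on the batches
`b, b + 1, …, b + k - 1`, starting from the parameters `θ`: draw the first noisy gradient `g̃`,
update `θ ← θ - η g̃`, and go on with the remaining `k - 1` steps. -/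
def stepsLaw : (k b : ℕ) → EuclideanSpace ℝ (Fin D) →
    Measure (Fin k → EuclideanSpace ℝ (Fin D))
  | 0, _, _ => Measure.dirac Fin.elim0
  | k + 1, b, θ => (stepLaw lam Lam σ C f x b θ).bind fun g =>
      (stepsLaw k (b + 1) (θ - η • g)).map
        fun v => (Fin.cons g v : Fin (k + 1) → EuclideanSpace ℝ (Fin D))

/-- The mechanism of one epoch, i.e. `⌊N λ / Λ⌋` training steps from the initial parameters `θ₀`.
It releases the noisy gradients used in all steps. -/
def epochMechanism (θ₀ : EuclideanSpace ℝ (Fin D)) :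
    Measure (Fin (N * lam / Lam) → EuclideanSpace ℝ (Fin D)) :=
  stepsLaw lam Lam σ C η f x (N * lam / Lam) 0 θ₀

/-! ### The mechanism is a probability measure -/

lemma measurable_clippedGradientSum (b : ℕ) (m : SampleMask N L LF lam Lam b) :
    Measurable fun θ => clippedGradientSum lam Lam C f x b θ m := by
  have hg : ∀ y, Measurable fun θ => clip C (f.lossGradient θ y) := by
    intro y
    have h : Measurable fun θ => f.lossGradient θ y := by
      unfold ForecastModel.lossGradient gradient
      exact (LinearIsometryEquiv.continuous _).measurable.comp (measurable_fderiv ℝ _)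
    unfold clip
    fun_prop
  unfold clippedGradientSum
  refine Finset.measurable_sum _ fun n _ => Finset.measurable_sum _ fun t _ => ?_
  split_ifs
  · exact hg _
  · exact measurable_const

lemma measurable_step (b : ℕ) :
    Measurable fun q : EuclideanSpace ℝ (Fin D) ×
        (SampleMask N L LF lam Lam b × EuclideanSpace ℝ (Fin D)) =>
      (Lam : ℝ)⁻¹ • (clippedGradientSum lam Lam C f x b q.1 q.2.1 + ((σ : ℝ) * C) • q.2.2) := by
  have h : Measurable fun q : EuclideanSpace ℝ (Fin D) × SampleMask N L LF lam Lam b =>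
      clippedGradientSum lam Lam C f x b q.1 q.2 :=
    measurable_from_prod_countable_left fun m => measurable_clippedGradientSum lam Lam C f x b m
  have h' := h.comp (measurable_fst.prodMk measurable_snd.fst :
    Measurable fun q : EuclideanSpace ℝ (Fin D) ×
      (SampleMask N L LF lam Lam b × EuclideanSpace ℝ (Fin D)) => (q.1, q.2.1))
  exact (h'.add (measurable_snd.snd.const_smul ((σ : ℝ) * C))).const_smul (Lam : ℝ)⁻¹

instance (b : ℕ) : IsProbabilityMeasure (poissonSampling N L LF lam Lam b) := by
  unfold poissonSampling; infer_instance

instance (b : ℕ) (θ : EuclideanSpace ℝ (Fin D)) :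
    IsProbabilityMeasure (stepLaw lam Lam σ C f x b θ) :=
  Measure.isProbabilityMeasure_map
    ((measurable_step lam Lam σ C f x b).comp measurable_prodMk_left).aemeasurable

lemma measurable_stepLaw (b : ℕ) : Measurable (stepLaw lam Lam σ C f x b) := by
  refine Measure.measurable_of_measurable_coe _ fun s hs => ?_
  have h := measurable_step lam Lam σ C f x b
  have : ∀ θ, stepLaw lam Lam σ C f x b θ s =
      ((poissonSampling N L LF lam Lam b).prod (stdGaussian (EuclideanSpace ℝ (Fin D))))
        (Prod.mk θ ⁻¹' ((fun q : EuclideanSpace ℝ (Fin D) ×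
          (SampleMask N L LF lam Lam b × EuclideanSpace ℝ (Fin D)) => (Lam : ℝ)⁻¹ •
            (clippedGradientSum lam Lam C f x b q.1 q.2.1 + ((σ : ℝ) * C) • q.2.2)) ⁻¹' s)) :=
    fun θ => Measure.map_apply (h.comp measurable_prodMk_left) hs
  simp_rw [this]
  exact measurable_measure_prodMk_left (h hs)

lemma stepsLaw_aux (k : ℕ) : ∀ b : ℕ, Measurable (stepsLaw lam Lam σ C η f x k b) ∧
    ∀ θ, IsProbabilityMeasure (stepsLaw lam Lam σ C η f x k b θ) := by
  induction k with
  | zero => exact fun b => ⟨measurable_const, fun θ => by unfold stepsLaw; infer_instance⟩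
  | succ k ih =>
    intro b
    obtain ⟨hm, hp⟩ := ih (b + 1)
    have hcons : Measurable fun q : EuclideanSpace ℝ (Fin D) × (Fin k → EuclideanSpace ℝ (Fin D)) =>
        (Fin.cons q.1 q.2 : Fin (k + 1) → EuclideanSpace ℝ (Fin D)) := by
      refine measurable_pi_lambda _ fun i => ?_
      refine Fin.cases ?_ (fun j => ?_) i
      · exact measurable_fst
      · exact (measurable_pi_apply j).comp measurable_snd
    have hcons' : ∀ g, Measurable
        fun v : Fin k → EuclideanSpace ℝ (Fin D) =>
          (Fin.cons g v : Fin (k + 1) → EuclideanSpace ℝ (Fin D)) :=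
      fun g => hcons.comp (measurable_prodMk_left (x := g))
    let κ : Kernel (EuclideanSpace ℝ (Fin D)) (Fin k → EuclideanSpace ℝ (Fin D)) := ⟨_, hm⟩
    have : IsMarkovKernel κ := ⟨hp⟩
    let ρ : Kernel (EuclideanSpace ℝ (Fin D) × EuclideanSpace ℝ (Fin D)) _ :=
      κ.comap (fun q => q.1 - η • q.2) (by fun_prop)
    have hF : Measurable fun q : EuclideanSpace ℝ (Fin D) × EuclideanSpace ℝ (Fin D) =>
        (stepsLaw lam Lam σ C η f x k (b + 1) (q.1 - η • q.2)).map
          fun v => (Fin.cons q.2 v : Fin (k + 1) → EuclideanSpace ℝ (Fin D)) := by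
      refine Measure.measurable_of_measurable_coe _ fun s hs => ?_
      simp_rw [Measure.map_apply (hcons' _) hs]
      have h2 : Measurable fun q : (EuclideanSpace ℝ (Fin D) × EuclideanSpace ℝ (Fin D)) ×
          (Fin k → EuclideanSpace ℝ (Fin D)) =>
          (Fin.cons q.1.2 q.2 : Fin (k + 1) → EuclideanSpace ℝ (Fin D)) :=
        hcons.comp (by fun_prop : Measurable fun q : (EuclideanSpace ℝ (Fin D) ×
          EuclideanSpace ℝ (Fin D)) × (Fin k → EuclideanSpace ℝ (Fin D)) => (q.1.2, q.2))
      exact Kernel.measurable_kernel_prodMk_left (κ := ρ) (h2 hs)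
    have hF' : ∀ θ, Measurable fun g =>
        (stepsLaw lam Lam σ C η f x k (b + 1) (θ - η • g)).map
          fun v => (Fin.cons g v : Fin (k + 1) → EuclideanSpace ℝ (Fin D)) :=
      fun θ => hF.comp measurable_prodMk_left
    constructor
    · refine Measure.measurable_of_measurable_coe _ fun s hs => ?_
      unfold stepsLaw
      simp_rw [Measure.bind_apply hs (hF' _).aemeasurable]
      let τ : Kernel (EuclideanSpace ℝ (Fin D)) (EuclideanSpace ℝ (Fin D)) :=
        ⟨_, measurable_stepLaw lam Lam σ C f x b⟩
      have : IsMarkovKernel τ := ⟨fun θ => by change IsProbabilityMeasure (stepLaw ..); infer_instance⟩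
      exact Measurable.lintegral_kernel_prod_right' (κ := τ) ((Measure.measurable_coe hs).comp hF)
    · intro θ
      constructor
      unfold stepsLaw
      rw [Measure.bind_apply MeasurableSet.univ (hF' θ).aemeasurable]
      have : ∀ g, ((stepsLaw lam Lam σ C η f x k (b + 1) (θ - η • g)).map
          fun v => (Fin.cons g v : Fin (k + 1) → EuclideanSpace ℝ (Fin D))) Set.univ = 1 := by
        intro g
        rw [Measure.map_apply (hcons' _) MeasurableSet.univ, Set.preimage_univ]
        exact (hp _).measure_univ
      simp [this]

instance (θ₀ : EuclideanSpace ℝ (Fin D)) :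
    IsProbabilityMeasure (epochMechanism lam Lam σ C η f x θ₀) :=
  (stepsLaw_aux lam Lam σ C η f x _ 0).2 θ₀

end Training

end

/-!
Write `α = exp ε` and `δ = H_α(P(λ) ‖ Q(λ))`; the point is that the mechanism satisfies the
inequality `M_x(φ) ≤ α M_x'(φ) + δ` for every test `0 ≤ φ ≤ 1`.

The modified sequence lies in one batch only. The noisy gradients of the earlier steps have the same
law for both datasets, and given the noisy gradient of its step so do those of the later steps, so
only the step on its batch matters. The modified event is seen by at most `L_C + L_F` subsequences.
Conditionally on the sampling of all others, the clipped gradients of these contribute a vector of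
norm at most `k C`, where `k` is the number of them that are sampled and has a binomial law. So both
laws of the noisy gradient are, up to a common shift and a scaling, mixtures of Gaussians whose
means have norm at most `k`.

It remains to compare these with the univariate mixtures of means `∓k`. Let `I` be the half-line
`(-∞, t]` whose measure under `𝒩(0, 1)` is the expectation of `φ` under the standard Gaussian. By
the Neyman–Pearson lemma, for every `u` with `‖u‖ ≤ k` the expectation of `φ` under the Gaussian of
mean `u` is at most `𝒩(-k, 1)(I)` and at least `𝒩(k, 1)(I)`. The half-line depends on `φ` only, not
on `k`, so the comparison passes to the mixtures.

The bound is attained by a loss that is linear in one parameter, with a slope `±C` that reveals the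
sign of the modified event.
-/

noncomputable section

/-! ### Indistinguishability -/

/-- `P` and `Q` are `(ε, δ)`-indistinguishable, where `α = exp ε`. It is formulated with randomized
tests `φ` instead of events, so that the inequality can be integrated over the randomness of `φ`. -/
def IsIndistinguishable {Ω : Type*} [MeasurableSpace Ω] (α : ℝ≥0) (δ : ℝ≥0∞) (P Q : Measure Ω) :
    Prop :=
  ∀ φ : Ω → ℝ≥0∞, Measurable φ → (∀ ω, φ ω ≤ 1) → ∫⁻ ω, φ ω ∂P ≤ α * ∫⁻ ω, φ ω ∂Q + δ

section Indistinguishability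

variable {Ω Ω' : Type*} [MeasurableSpace Ω] [MeasurableSpace Ω'] {α : ℝ≥0} {δ : ℝ≥0∞}
  {P Q : Measure Ω}

lemma isIndistinguishable_hockeyStick [SigmaFinite P] [SigmaFinite Q] (h : P ≪ Q) :
    IsIndistinguishable α (hockeyStick α P Q) P Q := by
  intro φ hφ hφ1
  calc ∫⁻ ω, φ ω ∂P = ∫⁻ ω, P.rnDeriv Q ω * φ ω ∂Q := (lintegral_rnDeriv_mul h hφ.aemeasurable).symm
    _ ≤ ∫⁻ ω, (α * φ ω + (P.rnDeriv Q ω - α)) ∂Q := by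
        refine lintegral_mono fun ω => ?_
        calc P.rnDeriv Q ω * φ ω ≤ (α + (P.rnDeriv Q ω - α)) * φ ω := by
              gcongr; exact le_add_tsub
          _ ≤ α * φ ω + (P.rnDeriv Q ω - α) := by
              rw [add_mul]; gcongr; exact mul_le_of_le_one_right' (hφ1 ω)
    _ = α * ∫⁻ ω, φ ω ∂Q + hockeyStick α P Q := by
        rw [lintegral_add_left (by fun_prop), lintegral_const_mul _ hφ, hockeyStick]

namespace IsIndistinguishable

lemma measure_le (h : IsIndistinguishable α δ P Q) {S : Set Ω} (hS : MeasurableSet S) :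
    P S ≤ α * Q S + δ := by
  simpa [lintegral_indicator_one hS] using
    h (S.indicator 1) (measurable_one.indicator hS) (Set.indicator_le_self' (by simp) ·)

lemma hockeyStick_le [IsFiniteMeasure Q] (h : IsIndistinguishable α δ P Q) :
    hockeyStick α P Q ≤ δ := by
  let S : Set Ω := {ω | α < P.rnDeriv Q ω}
  have hS : MeasurableSet S := measurableSet_lt measurable_const (Measure.measurable_rnDeriv P Q)
  calc hockeyStick α P Q = ∫⁻ ω in S, (P.rnDeriv Q ω - α) ∂Q := by
        rw [hockeyStick, ← lintegral_indicator hS]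
        refine lintegral_congr fun ω => ?_
        by_cases hω : ω ∈ S
        · rw [Set.indicator_of_mem hω]
        · rw [Set.indicator_of_notMem hω, tsub_eq_zero_of_le (not_lt.1 hω)]
    _ = ∫⁻ ω in S, P.rnDeriv Q ω ∂Q - α * Q S := by
        rw [lintegral_sub measurable_const (by simp [ENNReal.mul_eq_top])
          ((ae_restrict_iff' hS).2 (ae_of_all _ fun ω hω => le_of_lt hω)), setLIntegral_const]
    _ ≤ P S - α * Q S := by gcongr; exact Measure.setLIntegral_rnDeriv_le S
    _ ≤ δ := tsub_le_iff_left.2 (h.measure_le hS)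

lemma map (h : IsIndistinguishable α δ P Q) {f : Ω → Ω'} (hf : Measurable f) :
    IsIndistinguishable α δ (P.map f) (Q.map f) := by
  intro φ hφ hφ1
  rw [lintegral_map hφ hf, lintegral_map hφ hf]
  exact h _ (hφ.comp hf) fun ω => hφ1 (f ω)

lemma compProd_left [SFinite P] [SFinite Q] (h : IsIndistinguishable α δ P Q) (κ : Kernel Ω Ω')
    [IsMarkovKernel κ] : IsIndistinguishable α δ (P ⊗ₘ κ) (Q ⊗ₘ κ) := by
  intro φ hφ hφ1
  rw [Measure.lintegral_compProd hφ, Measure.lintegral_compProd hφ]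
  refine h _ hφ.lintegral_kernel_prod_right' fun ω => ?_
  calc ∫⁻ ω', φ (ω, ω') ∂κ ω ≤ ∫⁻ _, 1 ∂κ ω := lintegral_mono fun ω' => hφ1 _
    _ = 1 := by simp

lemma compProd_right [IsProbabilityMeasure P] {κ η : Kernel Ω Ω'} [IsSFiniteKernel κ]
    [IsSFiniteKernel η] (h : ∀ ω, IsIndistinguishable α δ (κ ω) (η ω)) :
    IsIndistinguishable α δ (P ⊗ₘ κ) (P ⊗ₘ η) := by
  intro φ hφ hφ1
  rw [Measure.lintegral_compProd hφ, Measure.lintegral_compProd hφ]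
  calc ∫⁻ ω, ∫⁻ ω', φ (ω, ω') ∂κ ω ∂P
      ≤ ∫⁻ ω, (α * ∫⁻ ω', φ (ω, ω') ∂η ω + δ) ∂P :=
        lintegral_mono fun ω => h ω _ (hφ.comp measurable_prodMk_left) fun ω' => hφ1 _
    _ = α * ∫⁻ ω, ∫⁻ ω', φ (ω, ω') ∂η ω ∂P + δ := by
        rw [lintegral_add_right _ measurable_const, lintegral_const_mul _
          hφ.lintegral_kernel_prod_right', lintegral_const, measure_univ, mul_one]

lemma one_le [IsProbabilityMeasure P] [IsProbabilityMeasure Q] (h : IsIndistinguishable α δ P Q) :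
    1 ≤ α + δ := by
  simpa using h 1 measurable_one fun _ => le_rfl

end IsIndistinguishable

lemma isIndistinguishable_self [IsProbabilityMeasure P] (h : 1 ≤ α + δ) :
    IsIndistinguishable α δ P P := by
  intro φ _ hφ1
  have hle : ∫⁻ ω, φ ω ∂P ≤ 1 := (lintegral_mono hφ1).trans_eq (by simp)
  calc ∫⁻ ω, φ ω ∂P ≤ (α + δ) * ∫⁻ ω, φ ω ∂P := le_mul_of_one_le_left' h
    _ ≤ α * ∫⁻ ω, φ ω ∂P + δ := by
        rw [add_mul]; gcongr; exact mul_le_of_le_one_right' hle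

lemma hockeyStick_map_le [IsFiniteMeasure P] [IsFiniteMeasure Q] (hPQ : P ≪ Q) {f : Ω → Ω'}
    (hf : Measurable f) : hockeyStick α (P.map f) (Q.map f) ≤ hockeyStick α P Q :=
  ((isIndistinguishable_hockeyStick hPQ).map hf).hockeyStick_le

end Indistinguishability

/-! ### Shifts of Gaussian measures -/

lemma ext_of_mgf_strongDual {E : Type*} [NormedAddCommGroup E] [NormedSpace ℝ E] [CompleteSpace E]
    [SecondCountableTopology E] [MeasurableSpace E] [BorelSpace E] {μ ν : Measure E}
    [IsProbabilityMeasure μ] [IsFiniteMeasure ν]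
    (hmgf : ∀ L : StrongDual ℝ E, mgf L μ = mgf L ν)
    (hint : ∀ L : StrongDual ℝ E, Integrable (fun z => Real.exp (L z)) μ) : μ = ν := by
  refine Measure.ext_of_charFunDual (funext fun L => ?_)
  have hset : integrableExpSet L μ = Set.univ := Set.eq_univ_of_forall fun s => hint (s • L)
  have h := eqOn_complexMGF_of_mgf (hmgf L) (x := (1 : ℝ) * Complex.I) (by simp [hset])
  rwa [complexMGF_mul_I (by fun_prop), complexMGF_mul_I (by fun_prop),
    ← charFunDual_eq_charFun_map_one, ← charFunDual_eq_charFun_map_one] at h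

section StdGaussian

open scoped RealInnerProductSpace

variable {E : Type*} [NormedAddCommGroup E] [InnerProductSpace ℝ E] [FiniteDimensional ℝ E]
  [MeasurableSpace E] [BorelSpace E]

lemma stdGaussian_map_strongDual (L : StrongDual ℝ E) :
    (stdGaussian E).map L = gaussianReal 0 (‖L‖₊ ^ 2) := by
  rw [IsGaussian.map_eq_gaussianReal, integral_strongDual_stdGaussian, variance_dual_stdGaussian]
  congr 1
  exact NNReal.eq (by simp)

lemma stdGaussian_real : stdGaussian ℝ = gaussianReal 0 1 := by
  simpa using stdGaussian_map_strongDual (ContinuousLinearMap.id ℝ ℝ)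

lemma stdGaussian_map_inner {e : E} (he : ‖e‖ = 1) :
    (stdGaussian E).map (inner ℝ e) = stdGaussian ℝ := by
  have hnorm : ‖innerSL ℝ e‖₊ = 1 := NNReal.eq (by simpa using he)
  simpa [hnorm, stdGaussian_real] using stdGaussian_map_strongDual (innerSL ℝ e)

lemma integral_exp_inner_stdGaussian (u : E) :
    ∫ z, Real.exp ⟪u, z⟫ ∂stdGaussian E = Real.exp (‖u‖ ^ 2 / 2) := by
  simpa [mgf] using mgf_gaussianReal (stdGaussian_map_strongDual (innerSL ℝ u)) 1

lemma integrable_exp_inner_stdGaussian (u : E) :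
    Integrable (fun z => Real.exp ⟪u, z⟫) (stdGaussian E) :=
  .of_integral_ne_zero (by simp [integral_exp_inner_stdGaussian])

/-- The Cameron–Martin formula. -/
theorem stdGaussian_map_add (u : E) :
    (stdGaussian E).map (u + ·) = (stdGaussian E).tilted (fun z => ⟪u, z⟫) := by
  have := isProbabilityMeasure_tilted (integrable_exp_inner_stdGaussian u)
  have : IsProbabilityMeasure ((stdGaussian E).map (u + ·)) :=
    Measure.isProbabilityMeasure_map (by fun_prop)
  refine ext_of_mgf_strongDual (fun L => funext fun s => ?_) fun L => ?_
  all_goals obtain ⟨t, rfl⟩ := (InnerProductSpace.toDual ℝ E).surjective L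
  · have hexp : ∀ z, s * ⟪t, z⟫ = ⟪s • t, z⟫ := fun z => (real_inner_smul_left ..).symm
    simp only [mgf, InnerProductSpace.toDual_apply_apply, hexp, integral_exp_tilted, Pi.add_apply,
      ← inner_add_left, integral_exp_inner_stdGaussian, ← Real.exp_sub]
    rw [integral_map (by fun_prop) (by fun_prop)]
    simp only [inner_add_right, Real.exp_add, integral_const_mul, integral_exp_inner_stdGaussian]
    rw [← Real.exp_add, norm_add_sq_real, real_inner_comm]
    ring_nf
  · rw [integrable_map_measure (by fun_prop) (by fun_prop)]
    simpa [Function.comp_def, inner_add_right, Real.exp_add] using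
      (integrable_exp_inner_stdGaussian t).const_mul _

lemma stdGaussian_map_add_absolutelyContinuous (u v : E) :
    (stdGaussian E).map (u + ·) ≪ (stdGaussian E).map (v + ·) := by
  rw [stdGaussian_map_add, stdGaussian_map_add]
  exact (tilted_absolutelyContinuous _ _).trans
    (absolutelyContinuous_tilted (integrable_exp_inner_stdGaussian v))

end StdGaussian

/-- The Neyman–Pearson lemma. -/
theorem lintegral_withDensity_le_of_superlevel {Ω : Type*} [MeasurableSpace Ω] {P : Measure Ω}
    [IsFiniteMeasure P] {ℓ : Ω → ℝ≥0} (hℓ : Measurable ℓ) {A : Set Ω} (hA : MeasurableSet A)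
    (hsuper : ∀ ω ∈ A, ∀ ω' ∉ A, ℓ ω' ≤ ℓ ω) {φ : Ω → ℝ≥0∞} (hφ : Measurable φ)
    (hφ1 : ∀ ω, φ ω ≤ 1) (hlevel : ∫⁻ ω, φ ω ∂P = P A) :
    ∫⁻ ω, φ ω ∂P.withDensity (fun ω => ℓ ω) ≤ P.withDensity (fun ω => ℓ ω) A := by
  have hℓ' : Measurable fun ω => (ℓ ω : ℝ≥0∞) := hℓ.coe_nnreal_ennreal
  obtain rfl | ⟨ω₀, hω₀⟩ := A.eq_empty_or_nonempty
  · have hφ0 : φ =ᵐ[P] 0 := (lintegral_eq_zero_iff hφ).1 (by rw [hlevel, measure_empty])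
    exact (lintegral_eq_zero_iff hφ).2 (withDensity_absolutelyContinuous _ _ hφ0)
      |>.trans_le zero_le
  obtain ⟨k, hk_le, hle_k⟩ : ∃ k : ℝ≥0, (∀ ω ∈ A, k ≤ ℓ ω) ∧ ∀ ω ∉ A, ℓ ω ≤ k :=
    ⟨⨆ ω : ↥Aᶜ, ℓ ω, fun ω hω => ciSup_le' fun ω' => hsuper ω hω ω' ω'.2,
      fun ω hω => le_ciSup (f := fun ω : ↥Aᶜ => ℓ ω)
        ⟨ℓ ω₀, Set.forall_mem_range.2 fun ω' => hsuper ω₀ hω₀ ω' ω'.2⟩ ⟨ω, hω⟩⟩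
  have hpointwise : ∀ ω, ℓ ω * φ ω + A.indicator (fun _ => (k : ℝ≥0∞)) ω ≤
      A.indicator (fun ω => (ℓ ω : ℝ≥0∞)) ω + k * φ ω := by
    intro ω
    by_cases hω : ω ∈ A
    · obtain ⟨e, he⟩ := exists_add_of_le (hk_le ω hω)
      simp only [Set.indicator_of_mem hω, he, ENNReal.coe_add]
      calc (k + e) * φ ω + k = k * φ ω + k + e * φ ω := by ring
        _ ≤ k * φ ω + k + e * 1 := by gcongr; exact hφ1 ω
        _ = k + e + k * φ ω := by ring
    · simpa [hω] using mul_le_mul_left (ENNReal.coe_le_coe.2 (hle_k ω hω)) (φ ω)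
  have hint := lintegral_mono hpointwise (μ := P)
  rw [lintegral_add_left (by fun_prop), lintegral_add_left (hℓ'.indicator hA),
    lintegral_indicator_const hA, lintegral_indicator hA, lintegral_const_mul _ hφ, hlevel] at hint
  rw [withDensity_apply _ hA, lintegral_withDensity_eq_lintegral_mul _ hℓ' hφ]
  exact (ENNReal.add_le_add_iff_right (by finiteness)).1 hint

lemma continuous_cdf (μ : Measure ℝ) [IsProbabilityMeasure μ] [NullSingletonClass μ] :
    Continuous (cdf μ) := by
  refine continuous_iff_continuousAt.2 fun x => ?_
  have h := measure_singleton (μ := μ) x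
  rw [← measure_cdf μ, StieltjesFunction.measure_singleton, ENNReal.ofReal_eq_zero,
    sub_nonpos] at h
  rw [(cdf μ).mono.continuousAt_iff_leftLim_eq_rightLim, StieltjesFunction.rightLim_eq]
  exact ((cdf μ).mono.leftLim_le le_rfl).antisymm h

lemma exists_isLowerSet_measure_eq (μ : Measure ℝ) [IsProbabilityMeasure μ] [NullSingletonClass μ]
    {q : ℝ≥0∞} (hq : q ≤ 1) : ∃ I : Set ℝ, IsLowerSet I ∧ μ I = q := by
  obtain rfl | hq0 := eq_or_ne q 0
  · exact ⟨∅, isLowerSet_empty, measure_empty⟩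
  obtain rfl | hq1 := hq.eq_or_lt
  · exact ⟨Set.univ, isLowerSet_univ, measure_univ⟩
  have hpos : 0 < q.toReal := ENNReal.toReal_pos hq0 hq1.ne_top
  have hlt : q.toReal < 1 := ENNReal.toReal_lt_of_lt_ofReal (by simpa using hq1)
  obtain ⟨c, hc⟩ := mem_range_of_exists_le_of_exists_ge (continuous_cdf μ)
    ((tendsto_cdf_atBot μ).eventually_le_const hpos).exists
    ((tendsto_cdf_atTop μ).eventually_const_le hlt).exists
  exact ⟨Set.Iic c, isLowerSet_Iic c, by rw [← ofReal_cdf, hc, ENNReal.ofReal_toReal hq1.ne_top]⟩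

lemma gaussianReal_eq_map_add (m : ℝ) (v : ℝ≥0) :
    gaussianReal m v = (gaussianReal 0 v).map (m + ·) := by
  rw [gaussianReal_map_const_add, zero_add]

lemma antitone_gaussianReal {I : Set ℝ} (hI : IsLowerSet I) (v : ℝ≥0) :
    Antitone fun m => gaussianReal m v I := by
  intro m m' h
  have hIm : MeasurableSet I := hI.ordConnected.measurableSet
  simp only [gaussianReal_eq_map_add m, gaussianReal_eq_map_add m',
    Measure.map_apply (measurable_const_add _) hIm]
  exact measure_mono fun y hy => hI (by simpa using h) hy

section StdGaussian

open scoped RealInnerProductSpace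

variable {E : Type*} [NormedAddCommGroup E] [InnerProductSpace ℝ E] [FiniteDimensional ℝ E]
  [MeasurableSpace E] [BorelSpace E] {I : Set ℝ} {φ : E → ℝ≥0∞}

lemma lintegral_stdGaussian_smul_add_le (hI : IsLowerSet I) (hφ : Measurable φ)
    (hφ1 : ∀ z, φ z ≤ 1) (hlevel : ∫⁻ z, φ z ∂stdGaussian E = gaussianReal 0 1 I)
    {e : E} (he : ‖e‖ = 1) {s : ℝ} (hs : 0 ≤ s) :
    ∫⁻ z, φ (s • e + z) ∂stdGaussian E ≤ gaussianReal (-s) 1 I := by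
  have hIm : MeasurableSet I := hI.ordConnected.measurableSet
  let T : StrongDual ℝ E := -innerSL ℝ e
  have hTm : Measurable T := by fun_prop
  have hTmap : (stdGaussian E).map T = gaussianReal 0 1 := by
    have hT : ‖T‖₊ = 1 := NNReal.eq (by simpa [T] using he)
    rw [stdGaussian_map_strongDual, hT, one_pow]
  have hTe : T e = -1 := by simp [T, he]
  have hsuper : ∀ z ∈ T ⁻¹' I, ∀ z' ∉ T ⁻¹' I, ⟪s • e, z'⟫ ≤ ⟪s • e, z⟫ := by
    intro z hz z' hz'
    have h : T z ≤ T z' := le_of_not_ge fun h => hz' (hI h hz)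
    rw [real_inner_smul_left, real_inner_smul_left]
    exact mul_le_mul_of_nonneg_left (neg_le_neg_iff.1 h) hs
  calc ∫⁻ z, φ (s • e + z) ∂stdGaussian E
      = ∫⁻ z, φ z ∂(stdGaussian E).tilted fun z => ⟪s • e, z⟫ := by
        rw [← stdGaussian_map_add, lintegral_map hφ (by fun_prop)]
    _ ≤ (stdGaussian E).tilted (fun z => ⟪s • e, z⟫) (T ⁻¹' I) :=
        lintegral_withDensity_le_of_superlevel (by fun_prop) (hTm hIm)
          (fun z hz z' hz' => Real.toNNReal_le_toNNReal
            (div_le_div_of_nonneg_right (Real.exp_le_exp.2 (hsuper z hz z' hz')) (by positivity)))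
          hφ hφ1 (by rw [hlevel, ← hTmap, Measure.map_apply hTm hIm])
    _ = gaussianReal (-s) 1 I := by
        rw [← stdGaussian_map_add, gaussianReal_eq_map_add, ← hTmap,
          Measure.map_map (by fun_prop) hTm, Measure.map_apply (by fun_prop) (hTm hIm),
          Measure.map_apply (by fun_prop) hIm]
        simp only [Set.preimage, Set.mem_ofPred_eq, Function.comp_apply, map_add, map_smul, hTe,
          smul_eq_mul, mul_neg, mul_one]

variable {u : E} {ρ : ℝ}

lemma lintegral_stdGaussian_add_le (hI : IsLowerSet I) (hφ : Measurable φ) (hφ1 : ∀ z, φ z ≤ 1)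
    (hlevel : ∫⁻ z, φ z ∂stdGaussian E = gaussianReal 0 1 I) (hu : ‖u‖ ≤ ρ) :
    ∫⁻ z, φ (u + z) ∂stdGaussian E ≤ gaussianReal (-ρ) 1 I := by
  refine le_trans ?_ (antitone_gaussianReal hI 1 (neg_le_neg hu))
  obtain rfl | hu0 := eq_or_ne u 0
  · simpa using hlevel.le
  · have hu' : ‖u‖ • (‖u‖⁻¹ • u) = u := smul_inv_smul₀ (norm_ne_zero_iff.2 hu0) u
    have he : ‖‖u‖⁻¹ • u‖ = 1 := norm_smul_inv_norm (𝕜 := ℝ) hu0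
    simpa only [hu'] using
      lintegral_stdGaussian_smul_add_le hI hφ hφ1 hlevel he (norm_nonneg u)

lemma le_lintegral_stdGaussian_add (hI : IsLowerSet I) (hφ : Measurable φ) (hφ1 : ∀ z, φ z ≤ 1)
    (hlevel : ∫⁻ z, φ z ∂stdGaussian E = gaussianReal 0 1 I) (hu : ‖u‖ ≤ ρ) :
    gaussianReal ρ 1 I ≤ ∫⁻ z, φ (u + z) ∂stdGaussian E := by
  have hIm : MeasurableSet I := hI.ordConnected.measurableSet
  have hcompl : ∀ m, gaussianReal (-m) 1 (-Iᶜ) = 1 - gaussianReal m 1 I := fun m => by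
    rw [← gaussianReal_map_neg, Measure.map_apply measurable_neg hIm.compl.neg,
      Set.neg_preimage, neg_neg, prob_compl_eq_one_sub hIm]
  have hsub : ∀ v : E, ∫⁻ z, (1 - φ (v + z)) ∂stdGaussian E =
      1 - ∫⁻ z, φ (v + z) ∂stdGaussian E := fun v => by
    rw [lintegral_sub (by fun_prop) ((lintegral_mono fun z => hφ1 _).trans_lt (by simp)).ne
      (ae_of_all _ fun z => hφ1 _), lintegral_one, measure_univ]
  have h := lintegral_stdGaussian_add_le (φ := fun z => 1 - φ z) hI.compl.neg (by fun_prop)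
    (fun z => tsub_le_self)
    (by simpa [hlevel] using (hsub 0).trans (congrArg (1 - ·) (by simpa using hlevel))
      |>.trans (hcompl 0).symm) hu
  rw [hcompl, hsub] at h
  have hle : gaussianReal ρ 1 I ≤ 1 := prob_le_one
  exact (ENNReal.sub_le_sub_iff_left hle ENNReal.one_ne_top).1 h

end StdGaussian

/-! ### Mixtures of Gaussians -/

/-- The law of `u ω + σ z` for `ω ∼ ν` and an independent standard Gaussian vector `z`, i.e. the
mixture of the Gaussians `𝒩(u ω, σ² I)`. -/
def gaussianMixture {Ω E : Type*} [MeasurableSpace Ω] [NormedAddCommGroup E]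
    [InnerProductSpace ℝ E] [FiniteDimensional ℝ E] [MeasurableSpace E] [BorelSpace E]
    (ν : Measure Ω) (u : Ω → E) (σ : ℝ) : Measure E :=
  (ν.prod (stdGaussian E)).map fun q => u q.1 + σ • q.2

section GaussianMixture

variable {Ω Ω' E : Type*} [MeasurableSpace Ω] [MeasurableSpace Ω'] [NormedAddCommGroup E]
  [InnerProductSpace ℝ E] [FiniteDimensional ℝ E] [MeasurableSpace E] [BorelSpace E]
  {μ : Measure Ω'} {ν : Measure Ω} {u u' : Ω → E} {σ : ℝ}

lemma isProbabilityMeasure_gaussianMixture [IsProbabilityMeasure ν] (hu : Measurable u) :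
    IsProbabilityMeasure (gaussianMixture ν u σ) :=
  Measure.isProbabilityMeasure_map (by fun_prop)

lemma lintegral_gaussianMixture [SFinite ν] (hu : Measurable u) {φ : E → ℝ≥0∞}
    (hφ : Measurable φ) :
    ∫⁻ z, φ z ∂gaussianMixture ν u σ = ∫⁻ ω, ∫⁻ z, φ (u ω + σ • z) ∂stdGaussian E ∂ν := by
  rw [gaussianMixture, lintegral_map hφ (by fun_prop), lintegral_prod _ (by fun_prop)]

lemma gaussianMixture_map [SFinite ν] {k : Ω → Ω'} (hk : Measurable k) {v : Ω' → E}
    (hv : Measurable v) :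
    gaussianMixture (ν.map k) v σ = gaussianMixture ν (v ∘ k) σ := by
  refine Measure.ext_of_lintegral _ fun φ hφ => ?_
  rw [lintegral_gaussianMixture hv hφ, lintegral_gaussianMixture (hv.comp hk) hφ,
    lintegral_map (by fun_prop) hk]
  rfl

lemma gaussianMixture_smul (hu : Measurable u) (c : ℝ) :
    (gaussianMixture ν u σ).map (c • ·) = gaussianMixture ν (fun ω => c • u ω) (c * σ) := by
  rw [gaussianMixture, Measure.map_map (by fun_prop) (by fun_prop), gaussianMixture]
  congr with q
  simp [smul_smul]

lemma gaussianMixture_map_inner [SFinite ν] (hu : Measurable u) {e : E} (he : ‖e‖ = 1) :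
    (gaussianMixture ν u σ).map (inner ℝ e) = gaussianMixture ν (fun ω => inner ℝ e (u ω)) σ := by
  refine Measure.ext_of_lintegral _ fun φ hφ => ?_
  rw [lintegral_map hφ (by fun_prop), lintegral_gaussianMixture hu (by fun_prop),
    lintegral_gaussianMixture (by fun_prop) hφ, ← stdGaussian_map_inner he]
  refine lintegral_congr fun ω => ?_
  rw [lintegral_map (by fun_prop) (by fun_prop)]
  simp only [inner_add_right, real_inner_smul_right, smul_eq_mul]

lemma gaussianMixture_absolutelyContinuous [SFinite ν] (hu : Measurable u) (hu' : Measurable u')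
    (hσ : σ ≠ 0) : gaussianMixture ν u σ ≪ gaussianMixture ν u' σ := by
  refine Measure.AbsolutelyContinuous.mk fun s hs h => ?_
  have hac : ∀ v v' : E, (stdGaussian E).map (v + σ • ·) ≪ (stdGaussian E).map (v' + σ • ·) := by
    intro v v'
    have hscale : ∀ v : E, (stdGaussian E).map (v + σ • ·) =
        ((stdGaussian E).map (σ⁻¹ • v + ·)).map (σ • ·) := fun v => by
      rw [Measure.map_map (by fun_prop) (by fun_prop)]
      simp [Function.comp_def, smul_inv_smul₀ hσ]
    rw [hscale, hscale]
    exact (stdGaussian_map_add_absolutelyContinuous _ _).map (by fun_prop)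
  have hae : ∀ {v : Ω → E}, Measurable v → (gaussianMixture ν v σ s = 0 ↔
      ∀ᵐ ω ∂ν, (stdGaussian E).map (v ω + σ • ·) s = 0) := fun {v} hv => by
    have hmap : ∀ ω, (stdGaussian E).map (v ω + σ • ·) s =
        stdGaussian E (Prod.mk ω ⁻¹' ((fun q => v q.1 + σ • q.2) ⁻¹' s)) := fun ω =>
      Measure.map_apply (by fun_prop) hs
    simp_rw [hmap]
    rw [gaussianMixture, Measure.map_apply (by fun_prop) hs,
      Measure.measure_prod_null (hs.preimage (by fun_prop))]
    rfl
  rw [hae hu'] at h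
  rw [hae hu]
  exact h.mono fun ω hω => hac _ _ hω

variable {ρ : Ω → ℝ}

lemma gaussianMixture_preimage [SFinite ν] (hρ : Measurable ρ) (hσ : σ ≠ 0) {I : Set ℝ}
    (hI : MeasurableSet I) :
    gaussianMixture ν ρ σ ((σ⁻¹ * ·) ⁻¹' I) = ∫⁻ ω, gaussianReal (σ⁻¹ * ρ ω) 1 I ∂ν := by
  rw [← lintegral_indicator_one (hI.preimage (by fun_prop)), lintegral_gaussianMixture hρ
    (measurable_one.indicator (hI.preimage (by fun_prop))), stdGaussian_real]
  refine lintegral_congr fun ω => ?_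
  rw [gaussianReal_eq_map_add (σ⁻¹ * ρ ω), ← lintegral_indicator_one hI,
    lintegral_map (measurable_one.indicator hI) (by fun_prop)]
  refine lintegral_congr fun z => ?_
  change I.indicator 1 (σ⁻¹ * (ρ ω + σ * z)) = _
  rw [mul_add, inv_mul_cancel_left₀ hσ]

theorem isIndistinguishable_gaussianMixture [SFinite ν] (hσ : 0 < σ)
    (hu : Measurable u) (hu' : Measurable u') (hρ : Measurable ρ)
    (huρ : ∀ ω, ‖u ω‖ ≤ ρ ω) (huρ' : ∀ ω, ‖u' ω‖ ≤ ρ ω) {α : ℝ≥0} {δ : ℝ≥0∞}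
    (h : IsIndistinguishable α δ (gaussianMixture ν (fun ω => -ρ ω) σ) (gaussianMixture ν ρ σ)) :
    IsIndistinguishable α δ (gaussianMixture ν u σ) (gaussianMixture ν u' σ) := by
  intro φ hφ hφ1
  have hφσ : Measurable fun z => φ (σ • z) := by fun_prop
  have := nullSingletonClass_gaussianReal (μ := 0) (v := 1) one_ne_zero
  obtain ⟨I, hI, hlevel⟩ := exists_isLowerSet_measure_eq (gaussianReal 0 1)
    ((lintegral_mono fun z => hφ1 (σ • z)).trans_eq (by simp) :
      ∫⁻ z, φ (σ • z) ∂stdGaussian E ≤ 1)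
  have hIm : MeasurableSet I := hI.ordConnected.measurableSet
  have hnorm : ∀ {v : E} {r : ℝ}, ‖v‖ ≤ r → ‖σ⁻¹ • v‖ ≤ σ⁻¹ * r := fun hv => by
    rw [norm_smul, Real.norm_of_nonneg (by positivity)]
    gcongr
  have hscale : ∀ v z : E, σ • (σ⁻¹ • v + z) = v + σ • z := fun v z => by
    rw [smul_add, smul_inv_smul₀ hσ.ne']
  have hle : ∫⁻ z, φ z ∂gaussianMixture ν u σ ≤
      gaussianMixture ν (fun ω => -ρ ω) σ ((σ⁻¹ * ·) ⁻¹' I) := by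
    rw [gaussianMixture_preimage (by fun_prop) hσ.ne' hIm, lintegral_gaussianMixture hu hφ]
    refine lintegral_mono fun ω => ?_
    simpa only [hscale, mul_neg] using lintegral_stdGaussian_add_le hI hφσ (fun z => hφ1 _)
      hlevel.symm (hnorm (huρ ω))
  have hge : gaussianMixture ν ρ σ ((σ⁻¹ * ·) ⁻¹' I) ≤ ∫⁻ z, φ z ∂gaussianMixture ν u' σ := by
    rw [gaussianMixture_preimage hρ hσ.ne' hIm, lintegral_gaussianMixture hu' hφ]
    refine lintegral_mono fun ω => ?_
    simpa only [hscale] using le_lintegral_stdGaussian_add hI hφσ (fun z => hφ1 _)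
      hlevel.symm (hnorm (huρ' ω))
  refine hle.trans (le_trans ?_ (add_le_add_left (mul_le_mul_right hge _) δ))
  exact h.measure_le (hIm.preimage (by fun_prop))

theorem isIndistinguishable_gaussianMixture_prod [IsProbabilityMeasure μ] [SFinite ν]
    {w : Ω' → E} (hw : Measurable w) (hu : Measurable u)
    (hu' : Measurable u') {α : ℝ≥0} {δ : ℝ≥0∞}
    (h : IsIndistinguishable α δ (gaussianMixture ν u σ) (gaussianMixture ν u' σ)) :
    IsIndistinguishable α δ (gaussianMixture (μ.prod ν) (fun q => w q.1 + u q.2) σ)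
      (gaussianMixture (μ.prod ν) (fun q => w q.1 + u' q.2) σ) := by
  intro φ hφ hφ1
  have hprod : ∀ {v : Ω → E}, Measurable v →
      ∫⁻ z, φ z ∂gaussianMixture (μ.prod ν) (fun q => w q.1 + v q.2) σ =
        ∫⁻ m, ∫⁻ z, φ (w m + z) ∂gaussianMixture ν v σ ∂μ := fun {v} hv => by
    rw [lintegral_gaussianMixture (by fun_prop) hφ, lintegral_prod _ (by fun_prop)]
    refine lintegral_congr fun m => ?_
    rw [lintegral_gaussianMixture hv (by fun_prop)]
    simp only [add_assoc]
  have hmeas : Measurable fun m => ∫⁻ z, φ (w m + z) ∂gaussianMixture ν u' σ := by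
    have : SFinite (gaussianMixture ν u' σ) := by rw [gaussianMixture]; infer_instance
    have hφw : Measurable fun q : Ω' × E => φ (w q.1 + q.2) := by fun_prop
    exact hφw.lintegral_prod_right'
  rw [hprod hu, hprod hu']
  calc ∫⁻ m, ∫⁻ z, φ (w m + z) ∂gaussianMixture ν u σ ∂μ
      ≤ ∫⁻ m, (α * ∫⁻ z, φ (w m + z) ∂gaussianMixture ν u' σ + δ) ∂μ :=
        lintegral_mono fun m => h _ (by fun_prop) fun z => hφ1 _
    _ = α * ∫⁻ m, ∫⁻ z, φ (w m + z) ∂gaussianMixture ν u' σ ∂μ + δ := by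
        rw [lintegral_add_right _ measurable_const, lintegral_const_mul _ hmeas, lintegral_const,
          measure_univ, mul_one]

end GaussianMixture

/-- The mixture of the Gaussians `𝒩(μ 0, σ²), …, 𝒩(μ K, σ²)` with the weights of the binomial
distribution with `K` trials and success probability `r`. -/
def binomialMoG (K : ℕ) (r : unitInterval) (μ : ℕ → ℝ) (σ : ℝ≥0) : Measure ℝ :=
  MoG (fun i : Fin (K + 1) => μ i) (fun i => (binomial K r).real {(i : ℕ)}) σ

section BinomialMoG

variable {Ω : Type*} [MeasurableSpace Ω] {ν : Measure Ω} {K : ℕ} {r : unitInterval} {μ : ℕ → ℝ}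
  {σ : ℝ≥0}

lemma gaussianReal_eq_map_add_smul (m : ℝ) (σ : ℝ≥0) :
    gaussianReal m (σ ^ 2) = (stdGaussian ℝ).map (m + (σ : ℝ) • ·) := by
  have hcomp : (fun z : ℝ => m + (σ : ℝ) • z) = (m + ·) ∘ ((σ : ℝ) * ·) := rfl
  rw [hcomp, ← Measure.map_map (by fun_prop) (by fun_prop), stdGaussian_real,
    gaussianReal_map_const_mul, gaussianReal_map_const_add]
  simp only [mul_zero, zero_add, mul_one]
  rfl

lemma gaussianMixture_binomial : gaussianMixture (binomial K r) μ σ = binomialMoG K r μ σ := by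
  refine Measure.ext_of_lintegral _ fun φ hφ => ?_
  rw [lintegral_gaussianMixture .of_discrete hφ, binomial_eq_sum_dirac, binomialMoG, MoG,
    lintegral_finsetSum_measure, lintegral_finsetSum_measure,
    Fin.sum_univ_eq_sum_range
      (fun k => ∫⁻ z, φ z ∂(ENNReal.ofReal ((binomial K r).real {k}) • gaussianReal (μ k) (σ ^ 2))),
    Nat.range_succ_eq_Iic]
  refine Finset.sum_congr rfl fun k _ => ?_
  rw [lintegral_smul_measure, lintegral_smul_measure, lintegral_dirac, binomial_real_singleton,
    gaussianReal_eq_map_add_smul, lintegral_map hφ (by fun_prop)]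

lemma gaussianMixture_eq_binomialMoG [SFinite ν] {k : Ω → ℕ} (hk : Measurable k)
    (hν : ν.map k = binomial K r) :
    gaussianMixture ν (fun ω => μ (k ω)) σ = binomialMoG K r μ σ := by
  rw [← gaussianMixture_binomial, ← hν, gaussianMixture_map hk .of_discrete]
  rfl

instance : IsProbabilityMeasure (binomialMoG K r μ σ) := by
  rw [← gaussianMixture_binomial]
  exact isProbabilityMeasure_gaussianMixture .of_discrete

lemma binomialMoG_absolutelyContinuous (hσ : 0 < σ) (μ' : ℕ → ℝ) :
    binomialMoG K r μ σ ≪ binomialMoG K r μ' σ := by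
  rw [← gaussianMixture_binomial, ← gaussianMixture_binomial]
  exact gaussianMixture_absolutelyContinuous .of_discrete .of_discrete
    (NNReal.coe_ne_zero.2 hσ.ne')

end BinomialMoG

section BernoulliArrays

variable {ι κ β : Type*} [Fintype ι] [Fintype κ] [MeasurableSpace β]

lemma measurePreserving_ite_prod {ν : Measure β} [IsProbabilityMeasure ν] (p : Prop) [Decidable p] :
    MeasurePreserving (fun q : β × β => if p then q.2 else q.1) (ν.prod ν) ν := by
  by_cases hp : p
  · simpa only [hp, if_true] using measurePreserving_snd
  · simpa only [hp, if_false] using measurePreserving_fst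

lemma measurePreserving_pi_prod {ν : Measure β} [IsProbabilityMeasure ν] {f : ι → β × β → β}
    (hf : ∀ i, MeasurePreserving (f i) (ν.prod ν) ν) :
    MeasurePreserving (fun q : (ι → β) × (ι → β) => fun i => f i (q.1 i, q.2 i))
      ((Measure.pi fun _ => ν).prod (Measure.pi fun _ => ν)) (Measure.pi fun _ => ν) :=
  (measurePreserving_pi _ _ hf).comp
    (measurePreserving_arrowProdEquivProdArrow β β ι (fun _ => ν) fun _ => ν).symm

lemma measurePreserving_pi_pi_ite {ν : Measure β} [IsProbabilityMeasure ν] (p : ι → κ → Prop)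
    [∀ i j, Decidable (p i j)] :
    MeasurePreserving
      (fun q : (ι → κ → β) × (ι → κ → β) => fun i j => if p i j then q.2 i j else q.1 i j)
      ((Measure.pi fun _ => Measure.pi fun _ => ν).prod (Measure.pi fun _ => Measure.pi fun _ => ν))
      (Measure.pi fun _ => Measure.pi fun _ => ν) :=
  measurePreserving_pi_prod fun i => measurePreserving_pi_prod fun j =>
    measurePreserving_ite_prod (p i j)

lemma map_setOf_pi_bernoulliMeasure (S : Set κ) (r : unitInterval) :
    (Measure.pi fun _ : κ => bernoulliMeasure true false r).map
      (fun a => {t | t ∈ S ∧ a t = true}) = setBernoulli S r := by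
  classical
  rw [setBernoulli_eq_map, Measure.infinitePi_eq_pi]
  have h : ∀ t, (bernoulliMeasure true false r).map (fun b => t ∈ S ∧ b = true) =
      unitInterval.toNNReal r • Measure.dirac (t ∈ S) +
        unitInterval.toNNReal (unitInterval.symm r) • Measure.dirac False := fun t => by
    rw [bernoulliMeasure_def, Measure.map_add _ _ .of_discrete, Measure.map_smul, Measure.map_smul,
      Measure.map_dirac' .of_discrete, Measure.map_dirac' .of_discrete]
    simp
  simp_rw [← h]
  rw [← Measure.pi_map_pi (fun _ => .of_discrete), Measure.map_map .of_discrete .of_discrete]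
  rfl

lemma map_card_filter_pi_bernoulliMeasure (S : Finset κ) (r : unitInterval) :
    (Measure.pi fun _ : κ => bernoulliMeasure true false r).map
      (fun a => (S.filter fun t => a t = true).card) = binomial S.card r := by
  have hcard : (fun a : κ → Bool => (S.filter fun t => a t = true).card) =
      Set.ncard ∘ fun a => {t | t ∈ (S : Set κ) ∧ a t = true} := by
    ext a
    rw [← Set.ncard_coe_finset, Finset.coe_filter]
    rfl
  refine Measure.ext_of_singleton fun k => ?_
  rw [hcard, ← Measure.map_map .of_discrete .of_discrete, map_setOf_pi_bernoulliMeasure,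
    map_ncard_setBernoulli_singleton S.finite_toSet, Set.ncard_coe_finset, binomial_singleton]

end BernoulliArrays

/-! ### The training steps -/

section Subsequences

variable {L LC LF : ℕ}

lemma subsequence_apply (LC LF : ℕ) {L : ℕ} (a : Fin L → ℝ) (t : Fin (numStarts L LF))
    (i : Fin (LC + LF)) :
    subsequence LC LF a t i = if h : LC ≤ (t : ℕ) + i then a ⟨t + i - LC, by
      have ht := t.isLt; have := i.isLt; unfold numStarts at ht; omega⟩ else 0 := by
  unfold subsequence Fin.append Fin.addCases
  split_ifs with h1 h2 h2
  · simp only at h1; omega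
  · rfl
  · simp only [eq_rec_constant]; rfl
  · simp only at h1; omega

lemma subsequence_eq_of_forall_ne {a a' : Fin L → ℝ} {s₀ : Fin L}
    (h : ∀ s ≠ s₀, a s = a' s) {t : Fin (numStarts L LF)}
    (ht : LC + s₀ < t ∨ t + (LC + LF) ≤ LC + s₀) :
    subsequence LC LF a t = subsequence LC LF a' t := by
  ext i
  rw [subsequence_apply, subsequence_apply]
  split_ifs with hi
  · refine h _ fun hs => ?_
    have hs' := congrArg Fin.val hs
    simp only at hs'
    omega
  · rfl

lemma card_filter_le_and_lt_add_le {n : ℕ} (s w : ℕ) :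
    ({t : Fin n | (t : ℕ) ≤ s ∧ s < t + w} : Finset (Fin n)).card ≤ w := by
  conv_rhs => rw [← Finset.card_range w]
  refine Finset.card_le_card_of_injOn (fun t => s - t) ?_ ?_
  · intro t ht
    simp only [Finset.coe_filter, Finset.mem_univ, true_and, Set.mem_ofPred_eq] at ht
    simp only [Finset.coe_range, Set.mem_Iio]
    omega
  · intro t ht t' ht' htt
    simp only [Finset.coe_filter, Finset.mem_univ, true_and, Set.mem_ofPred_eq] at ht ht' htt
    ext
    omega

lemma exists_card_eq_subsequence_eq (hL : LC + LF ≤ numStarts L LF) {a a' : Fin L → ℝ}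
    {s₀ : Fin L} (h : ∀ s ≠ s₀, a s = a' s) :
    ∃ S : Finset (Fin (numStarts L LF)), S.card = LC + LF ∧
      ∀ t ∉ S, subsequence LC LF a t = subsequence LC LF a' t := by
  obtain ⟨S, hAS, hS⟩ := Finset.exists_superset_card_eq
    (card_filter_le_and_lt_add_le (n := numStarts L LF) (LC + s₀) (LC + LF))
    (by rwa [Fintype.card_fin])
  refine ⟨S, hS, fun t ht => subsequence_eq_of_forall_ne h ?_⟩
  by_contra! hcon
  exact ht (hAS (Finset.mem_filter.2 ⟨Finset.mem_univ _, hcon⟩))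

end Subsequences

lemma norm_clip_le {D : ℕ} {C : ℝ} (hC : 0 < C) (g : EuclideanSpace ℝ (Fin D)) :
    ‖clip C g‖ ≤ C := by
  have hmax : 0 < max 1 (‖g‖ / C) := lt_max_of_lt_left one_pos
  rw [clip, norm_smul, norm_inv, Real.norm_of_nonneg hmax.le, inv_mul_le_iff₀ hmax]
  exact (div_le_iff₀ hC).1 (le_max_right _ _)

section Step

variable {L LC LF N D : ℕ} {lam Lam : ℕ} {σ : ℝ≥0} {C : ℝ} {f : ForecastModel.{u} D LC LF}
  {x x' : Dataset N L} {b : ℕ} {θ : EuclideanSpace ℝ (Fin D)}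

/-- The number of those subsequences of the sequence `n` with a start index in `S` that are
sampled. -/
def sampledCount (n : topLevelBatch N lam Lam b) (S : Finset (Fin (numStarts L LF)))
    (m : SampleMask N L LF lam Lam b) : ℕ :=
  (S.filter fun t => m n t = true).card

/-- The mask `m` with the entries `(n, t)`, `t ∈ S`, replaced by those of `m'`. -/
def resample (n : topLevelBatch N lam Lam b) (S : Finset (Fin (numStarts L LF)))
    (m m' : SampleMask N L LF lam Lam b) : SampleMask N L LF lam Lam b :=
  fun i t => if i = n ∧ t ∈ S then m' i t else m i t

variable {n : topLevelBatch N lam Lam b} {S : Finset (Fin (numStarts L LF))}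

lemma measurePreserving_resample :
    MeasurePreserving (Function.uncurry (resample n S))
      ((poissonSampling N L LF lam Lam b).prod (poissonSampling N L LF lam Lam b))
      (poissonSampling N L LF lam Lam b) :=
  measurePreserving_pi_pi_ite _

lemma map_sampledCount_poissonSampling :
    (poissonSampling N L LF lam Lam b).map (sampledCount n S) =
      binomial S.card (samplingRate L LF lam) := by
  have hcomp : sampledCount n S = (fun a => (S.filter fun t => a t = true).card) ∘
    Function.eval n := rfl
  rw [hcomp, ← Measure.map_map .of_discrete .of_discrete, poissonSampling,
    (measurePreserving_eval _ n).map_eq, map_card_filter_pi_bernoulliMeasure]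

lemma clippedGradientSum_resample (m m' : SampleMask N L LF lam Lam b) :
    clippedGradientSum lam Lam C f x b θ (resample n S m m') =
      clippedGradientSum lam Lam C f x b θ (resample n S m ⊥) +
        clippedGradientSum lam Lam C f x b θ (resample n S ⊥ m') := by
  simp only [clippedGradientSum, ← Finset.sum_add_distrib]
  refine Finset.sum_congr rfl fun i _ => Finset.sum_congr rfl fun t _ => ?_
  by_cases h : i = n ∧ t ∈ S <;> simp [resample, h]

lemma clippedGradientSum_resample_bot_left (m : SampleMask N L LF lam Lam b) :
    clippedGradientSum lam Lam C f x b θ (resample n S ⊥ m) =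
      ∑ t ∈ S with m n t = true, clip C (f.lossGradient θ (subsequence LC LF (x n) t)) := by
  rw [clippedGradientSum, Finset.sum_eq_single n]
  · rw [Finset.sum_filter, ← Finset.sum_subset (Finset.subset_univ S)]
    · refine Finset.sum_congr rfl fun t ht => ?_
      simp [resample, ht]
    · intro t _ ht
      simp [resample, ht]
  · intro i _ hi
    simp [resample, hi]
  · simp

lemma norm_clippedGradientSum_resample_bot_left_le (hC : 0 < C)
    (m : SampleMask N L LF lam Lam b) :
    ‖clippedGradientSum lam Lam C f x b θ (resample n S ⊥ m)‖ ≤ sampledCount n S m * C := by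
  rw [clippedGradientSum_resample_bot_left]
  exact (norm_sum_le_of_le _ fun t _ => norm_clip_le hC _).trans_eq (by simp [sampledCount])

lemma clippedGradientSum_resample_bot_right_congr (hx : ∀ i : Fin N, i ≠ n → x i = x' i)
    (hS : ∀ t ∉ S, subsequence LC LF (x n) t = subsequence LC LF (x' n) t)
    (m : SampleMask N L LF lam Lam b) :
    clippedGradientSum lam Lam C f x b θ (resample n S m ⊥) =
      clippedGradientSum lam Lam C f x' b θ (resample n S m ⊥) := by
  refine Finset.sum_congr rfl fun i _ => Finset.sum_congr rfl fun t _ => ?_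
  by_cases hi : i = n
  · subst hi
    by_cases ht : t ∈ S
    · simp [resample, ht]
    · rw [hS t ht]
  · rw [hx i fun h => hi (Subtype.ext h)]

lemma stepLaw_eq_map_gaussianMixture (hC : C ≠ 0) :
    stepLaw lam Lam σ C f x b θ = (gaussianMixture (poissonSampling N L LF lam Lam b)
      (fun m => C⁻¹ • clippedGradientSum lam Lam C f x b θ m) σ).map ((C / Lam) • ·) := by
  rw [gaussianMixture_smul .of_discrete, stepLaw, gaussianMixture]
  congr 1
  funext ω
  rw [smul_smul, smul_add, smul_smul]
  congr 2
  · field_simp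
  · ring

lemma stepLaw_absolutelyContinuous (hσ : 0 < σ) (hC : C ≠ 0) :
    stepLaw lam Lam σ C f x b θ ≪ stepLaw lam Lam σ C f x' b θ := by
  rw [stepLaw_eq_map_gaussianMixture hC, stepLaw_eq_map_gaussianMixture hC]
  exact (gaussianMixture_absolutelyContinuous .of_discrete .of_discrete
    (NNReal.coe_ne_zero.2 hσ.ne')).map (by fun_prop)

lemma stepLaw_congr (h : ∀ n ∈ topLevelBatch N lam Lam b, x n = x' n) :
    stepLaw lam Lam σ C f x b θ = stepLaw lam Lam σ C f x' b θ := by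
  have hsum : clippedGradientSum lam Lam C f x b θ = clippedGradientSum lam Lam C f x' b θ :=
    funext fun m => Finset.sum_congr rfl fun n _ => by rw [h n n.2]
  rw [stepLaw, hsum, stepLaw]

lemma gaussianMixture_clippedGradientSum_eq_resample (c : ℝ) :
    gaussianMixture (poissonSampling N L LF lam Lam b)
        (fun m => c • clippedGradientSum lam Lam C f x b θ m) σ =
      gaussianMixture ((poissonSampling N L LF lam Lam b).prod (poissonSampling N L LF lam Lam b))
        (fun q => c • clippedGradientSum lam Lam C f x b θ (resample n S q.1 ⊥) +
          c • clippedGradientSum lam Lam C f x b θ (resample n S ⊥ q.2)) σ := by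
  conv_lhs => rw [← (measurePreserving_resample (n := n) (S := S)).map_eq]
  rw [gaussianMixture_map .of_discrete .of_discrete]
  congr 1
  funext q
  rw [← smul_add, ← clippedGradientSum_resample]
  rfl

theorem isIndistinguishable_stepLaw (hσ : 0 < σ) (hC : 0 < C)
    (hx : ∀ i : Fin N, i ≠ n → x i = x' i)
    (hS : ∀ t ∉ S, subsequence LC LF (x n) t = subsequence LC LF (x' n) t)
    {α : ℝ≥0} {δ : ℝ≥0∞}
    (h : IsIndistinguishable α δ
      (binomialMoG S.card (samplingRate L LF lam) (fun k => -(k : ℝ)) σ)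
      (binomialMoG S.card (samplingRate L LF lam) (fun k => (k : ℝ)) σ)) :
    IsIndistinguishable α δ (stepLaw lam Lam σ C f x b θ) (stepLaw lam Lam σ C f x' b θ) := by
  have hnorm : ∀ (y : Dataset N L) (m : SampleMask N L LF lam Lam b),
      ‖C⁻¹ • clippedGradientSum lam Lam C f y b θ (resample n S ⊥ m)‖ ≤ sampledCount n S m := by
    intro y m
    rw [norm_smul, norm_inv, Real.norm_of_nonneg hC.le, inv_mul_le_iff₀ hC, mul_comm]
    exact norm_clippedGradientSum_resample_bot_left_le hC m
  have hpart : IsIndistinguishable α δ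
      (gaussianMixture (poissonSampling N L LF lam Lam b)
        (fun m => C⁻¹ • clippedGradientSum lam Lam C f x b θ (resample n S ⊥ m)) σ)
      (gaussianMixture (poissonSampling N L LF lam Lam b)
        (fun m => C⁻¹ • clippedGradientSum lam Lam C f x' b θ (resample n S ⊥ m)) σ) := by
    refine isIndistinguishable_gaussianMixture (ρ := fun m => (sampledCount n S m : ℝ))
      (NNReal.coe_pos.2 hσ) .of_discrete .of_discrete .of_discrete (hnorm x) (hnorm x') ?_
    rwa [gaussianMixture_eq_binomialMoG (μ := fun k => -(k : ℝ)) .of_discrete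
      map_sampledCount_poissonSampling, gaussianMixture_eq_binomialMoG (μ := fun k => (k : ℝ))
      .of_discrete map_sampledCount_poissonSampling]
  have hprod := isIndistinguishable_gaussianMixture_prod
    (μ := poissonSampling N L LF lam Lam b)
    (w := fun m => C⁻¹ • clippedGradientSum lam Lam C f x' b θ (resample n S m ⊥))
    .of_discrete .of_discrete .of_discrete hpart
  rw [stepLaw_eq_map_gaussianMixture hC.ne', stepLaw_eq_map_gaussianMixture hC.ne',
    gaussianMixture_clippedGradientSum_eq_resample (n := n) (S := S),
    gaussianMixture_clippedGradientSum_eq_resample (n := n) (S := S)]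
  simp only [clippedGradientSum_resample_bot_right_congr (f := f) (θ := θ) hx hS]
  exact hprod.map (measurable_const_smul _)

end Step

lemma measurable_fin_cons {V : Type*} [MeasurableSpace V] {k : ℕ} :
    Measurable fun q : V × (Fin k → V) => (Fin.cons q.1 q.2 : Fin (k + 1) → V) :=
  measurable_pi_lambda _ (Fin.cases measurable_fst fun j => (measurable_pi_apply j).comp
    measurable_snd)

section Composition

variable {L LC LF N D : ℕ} {lam Lam : ℕ} {σ : ℝ≥0} {C η : ℝ} {f : ForecastModel.{u} D LC LF}
  {x x' : Dataset N L} {n : Fin N} {k b : ℕ} {θ : EuclideanSpace ℝ (Fin D)}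

lemma notMem_topLevelBatch_of_lt (hn : n ∈ topLevelBatch N lam Lam b) {c : ℕ} (hbc : b < c) :
    n ∉ topLevelBatch N lam Lam c := by
  simp only [topLevelBatch, Finset.mem_filter, Finset.mem_univ, true_and, not_and, not_lt] at hn ⊢
  have := Nat.mul_le_mul_right (Lam / lam) (Nat.succ_le_of_lt hbc)
  rw [Nat.succ_eq_add_one] at this
  omega

variable (lam Lam σ C η f x k b θ) in
/-- The law of the noisy gradients of the `k` steps from the `b`-th batch onwards, as a Markov
kernel in the noisy gradient `g` of the step that precedes them and starts from `θ`. -/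
def remainingSteps :
    Kernel (EuclideanSpace ℝ (Fin D)) (Fin k → EuclideanSpace ℝ (Fin D)) where
  toFun g := stepsLaw lam Lam σ C η f x k b (θ - η • g)
  measurable' := (stepsLaw_aux lam Lam σ C η f x k b).1.comp (by fun_prop)

instance : IsMarkovKernel (remainingSteps lam Lam σ C η f x k b θ) :=
  ⟨fun _ => (stepsLaw_aux lam Lam σ C η f x k b).2 _⟩

lemma stepsLaw_succ : stepsLaw lam Lam σ C η f x (k + 1) b θ =
    (stepLaw lam Lam σ C f x b θ ⊗ₘ remainingSteps lam Lam σ C η f x k (b + 1) θ).map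
      fun q => Fin.cons q.1 q.2 := by
  rw [Measure.compProd_eq_comp_prod, Measure.map_comp _ _ measurable_fin_cons, stepsLaw]
  congr 1
  funext g
  rw [Kernel.map_apply _ measurable_fin_cons, Kernel.prod_apply, Kernel.id_apply,
    Measure.dirac_prod, Measure.map_map measurable_fin_cons measurable_prodMk_left]
  rfl

lemma map_stepsLaw_eval_zero : (stepsLaw lam Lam σ C η f x (k + 1) b θ).map (Function.eval 0) =
    stepLaw lam Lam σ C f x b θ := by
  rw [stepsLaw_succ, Measure.map_map (measurable_pi_apply 0) measurable_fin_cons]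
  exact Measure.fst_compProd _ _

lemma stepsLaw_absolutelyContinuous (hσ : 0 < σ) (hC : C ≠ 0) :
    stepsLaw lam Lam σ C η f x k b θ ≪ stepsLaw lam Lam σ C η f x' k b θ := by
  induction k generalizing b θ with
  | zero => exact .rfl
  | succ k ih =>
    rw [stepsLaw_succ, stepsLaw_succ]
    exact ((stepLaw_absolutelyContinuous hσ hC).compProd (ae_of_all _ fun _ => ih)).map
      measurable_fin_cons

lemma stepsLaw_congr (h : ∀ c, b ≤ c → ∀ n ∈ topLevelBatch N lam Lam c, x n = x' n) :
    stepsLaw lam Lam σ C η f x k b θ = stepsLaw lam Lam σ C η f x' k b θ := by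
  induction k generalizing b θ with
  | zero => rfl
  | succ k ih =>
    rw [stepsLaw, stepsLaw, stepLaw_congr (h b le_rfl)]
    congr 1
    funext g
    rw [ih fun c hc => h c (by omega)]

theorem isIndistinguishable_stepsLaw {α : ℝ≥0} {δ : ℝ≥0∞} (hx : ∀ m ≠ n, x m = x' m)
    (hstep : ∀ (b : ℕ) (θ : EuclideanSpace ℝ (Fin D)), n ∈ topLevelBatch N lam Lam b →
      IsIndistinguishable α δ (stepLaw lam Lam σ C f x b θ) (stepLaw lam Lam σ C f x' b θ))
    (hαδ : 1 ≤ α + δ) :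
    IsIndistinguishable α δ (stepsLaw lam Lam σ C η f x k b θ)
      (stepsLaw lam Lam σ C η f x' k b θ) := by
  induction k generalizing b θ with
  | zero => exact isIndistinguishable_self (P := .dirac _) hαδ
  | succ k ih =>
    rw [stepsLaw_succ, stepsLaw_succ]
    refine IsIndistinguishable.map ?_ measurable_fin_cons
    by_cases hn : n ∈ topLevelBatch N lam Lam b
    · have hrest : remainingSteps lam Lam σ C η f x k (b + 1) θ =
          remainingSteps lam Lam σ C η f x' k (b + 1) θ := Kernel.ext fun g =>
        stepsLaw_congr fun c hc m hm =>
          hx m (ne_of_mem_of_not_mem hm (notMem_topLevelBatch_of_lt hn hc))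
      rw [hrest]
      exact (hstep b θ hn).compProd_left _
    · rw [stepLaw_congr fun m hm => hx m (ne_of_mem_of_not_mem hm hn)]
      exact .compProd_right fun g => ih

theorem privacyProfile_epochMechanism_le (hL : LC + LF ≤ numStarts L LF) (hσ : 0 < σ) (hC : 0 < C)
    (θ₀ : EuclideanSpace ℝ (Fin D)) (α : ℝ≥0) :
    privacyProfile (EventNeighbor 1)
        (fun x : Dataset N L => epochMechanism lam Lam σ C η f x θ₀) α ≤
      hockeyStick α (binomialMoG (LC + LF) (samplingRate L LF lam) (fun k => -(k : ℝ)) σ)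
        (binomialMoG (LC + LF) (samplingRate L LF lam) (fun k => (k : ℝ)) σ) := by
  refine iSup_le fun x => iSup_le fun x' => iSup_le fun ⟨n, hx, _, s₀, hs₀⟩ => ?_
  obtain ⟨S, hS, hSsub⟩ := exists_card_eq_subsequence_eq hL (a := x n) (a' := x' n) (s₀ := s₀)
    fun s hs => by
      by_contra hne
      exact hs (Fin.ext (by have := hs₀ s hne; omega))
  have hMoG := isIndistinguishable_hockeyStick (α := α)
    (binomialMoG_absolutelyContinuous (K := LC + LF) (r := samplingRate L LF lam)
      (μ := fun k => -(k : ℝ)) hσ fun k => (k : ℝ))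
  have := (stepsLaw_aux lam Lam σ C η f x' (N * lam / Lam) 0).2 θ₀
  refine IsIndistinguishable.hockeyStick_le
    (isIndistinguishable_stepsLaw hx (fun b θ hn => ?_) hMoG.one_le)
  rw [← hS] at hMoG ⊢
  exact isIndistinguishable_stepLaw (n := ⟨n, hn⟩) hσ hC hx hSsub hMoG

end Composition

/-! ### A model that attains the bound -/

/-- A detector for events of size at most `1`: the sum of the entries of `w` in `[-1, 1]`. -/
def marker {ι : Type*} [Fintype ι] (w : ι → ℝ) : ℝ :=
  ∑ i, (Set.Icc (-1) 1).indicator id (w i)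

/-- The model whose loss is linear in the `d`-th parameter, with `C` times the `marker` of the
subsequence as slope. -/
def markerModel {D : ℕ} (LC LF : ℕ) (C : ℝ) (d : Fin D) : ForecastModel.{u} D LC LF where
  Pred := ULift.{u} (ℝ × ℝ)
  predict θ c := ⟨θ d, marker c⟩
  loss q y := C * (q.down.2 + marker y) * q.down.1
  differentiable_loss c y := by
    change Differentiable ℝ fun θ : EuclideanSpace ℝ (Fin D) => C * (marker c + marker y) * θ d
    fun_prop

/-- The dataset of `N` sequences with an event of size `s` at the index `j` of the sequence `0`,
which is zero otherwise. The sequences `1, 2, …` are constant, with entries that the `marker`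
ignores. -/
def markedDataset (N : ℕ) {L : ℕ} (j : Fin L) {s : ℝ} (hs : s < 2) : Dataset N L where
  toFun n := if (n : ℕ) = 0 then Pi.single j s else fun _ => (n : ℝ) + 1
  inj' n n' h := by
    have hlt : ∀ {m : ℕ}, m ≠ 0 → s < m + 1 := fun {m} hm => by
      have : (1 : ℝ) ≤ m := Nat.one_le_cast.2 (Nat.one_le_iff_ne_zero.2 hm)
      linarith
    have hj := congrFun h j
    ext
    by_cases hn : (n : ℕ) = 0 <;> by_cases hn' : (n' : ℕ) = 0
    · rw [hn, hn']
    · simp [hn, hn', (hlt hn').ne] at hj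
    · simp [hn, hn', (hlt hn).ne'] at hj
    · simpa [hn, hn'] using hj

lemma markedDataset_apply {N L : ℕ} (j : Fin L) {s : ℝ} (hs : s < 2) (n : Fin N) :
    markedDataset N j hs n = if (n : ℕ) = 0 then Pi.single j s else fun _ => (n : ℝ) + 1 := rfl

section Tightness

variable {L LC LF N D : ℕ} {lam Lam : ℕ} {σ : ℝ≥0} {C η : ℝ} {d : Fin D} {j : Fin L} {s : ℝ}
  {b : ℕ} {θ : EuclideanSpace ℝ (Fin D)}

lemma marker_subsequence_single (hj : (j : ℕ) + 1 = LF) (hs : |s| ≤ 1)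
    (t : Fin (numStarts L LF)) :
    marker (subsequence LC LF (Pi.single j s) t) = if (t : ℕ) < LC + LF then s else 0 := by
  have hentry : ∀ i, subsequence LC LF (Pi.single j s : Fin L → ℝ) t i =
      if (t : ℕ) + i + 1 = LC + LF then s else 0 := fun i => by
    rw [subsequence_apply]
    simp only [Pi.single_apply, Fin.ext_iff]
    split_ifs <;> first | rfl | omega
  have hind : ∀ i, (Set.Icc (-1) 1).indicator id (subsequence LC LF (Pi.single j s) t i) =
      if (t : ℕ) + i + 1 = LC + LF then s else 0 := fun i => by
    rw [hentry]
    split_ifs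
    · exact Set.indicator_of_mem (Set.mem_Icc.2 (abs_le.1 hs)) _
    · simp
  simp only [marker, hind]
  split_ifs with ht
  · rw [Finset.sum_eq_single ⟨LC + LF - 1 - t, by omega⟩]
    · exact if_pos (by simp only; omega)
    · exact fun i _ hi => if_neg fun h => hi (Fin.ext (by simp only; omega))
    · simp
  · exact Finset.sum_eq_zero fun i _ => if_neg (by omega)

lemma marker_subsequence_const {c : ℝ} (hc : 1 < c) (t : Fin (numStarts L LF)) :
    marker (subsequence LC LF (fun _ : Fin L => c) t) = 0 := by
  refine Finset.sum_eq_zero fun i _ => ?_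
  rw [subsequence_apply]
  split_ifs
  · exact Set.indicator_of_notMem (fun h => h.2.not_gt hc) _
  · simp

lemma marker_subsequence_markedDataset (hj : (j : ℕ) + 1 = LF) (hs : |s| ≤ 1) (hs2 : s < 2)
    (n : Fin N) (t : Fin (numStarts L LF)) :
    marker (subsequence LC LF (markedDataset N j hs2 n) t) =
      if (n : ℕ) = 0 ∧ (t : ℕ) < LC + LF then s else 0 := by
  rw [markedDataset_apply]
  by_cases hn : (n : ℕ) = 0
  · simp only [hn, if_true, true_and, marker_subsequence_single hj hs]
  · simp only [hn, if_false, false_and]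
    exact marker_subsequence_const
      (lt_add_of_pos_left _ (Nat.cast_pos.2 (Nat.pos_of_ne_zero hn))) t

lemma lossGradient_markerModel (y : Fin (LC + LF) → ℝ) :
    (markerModel.{u} LC LF C d).lossGradient θ y =
      (C * marker y) • EuclideanSpace.single d (1 : ℝ) := by
  refine HasGradientAt.gradient ?_
  rw [hasGradientAt_iff_hasFDerivAt]
  refine (ContinuousLinearMap.hasFDerivAt _).congr_of_eventuallyEq (.of_forall fun θ' => ?_)
  have hsplit : marker y = marker (fun i : Fin LC => y (Fin.castAdd LF i)) +
      marker fun i : Fin LF => y (Fin.natAdd LC i) := Fin.sum_univ_add _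
  simp [markerModel, hsplit, EuclideanSpace.inner_single_left]

lemma clip_lossGradient_markerModel (hC : 0 < C) {y : Fin (LC + LF) → ℝ} (hy : |marker y| ≤ 1) :
    clip C ((markerModel.{u} LC LF C d).lossGradient θ y) =
      (C * marker y) • EuclideanSpace.single d (1 : ℝ) := by
  have hnorm : ‖(C * marker y) • EuclideanSpace.single d (1 : ℝ)‖ ≤ C := by
    rw [norm_smul, PiLp.norm_single, norm_one, mul_one, Real.norm_eq_abs, abs_mul,
      abs_of_pos hC]
    exact mul_le_of_le_one_right hC.le hy
  rw [lossGradient_markerModel, clip, max_eq_left ((div_le_one hC).2 hnorm), inv_one, one_smul]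

lemma clippedGradientSum_markedDataset (hC : 0 < C) (hj : (j : ℕ) + 1 = LF) (hs : |s| ≤ 1)
    (hs2 : s < 2) (n : topLevelBatch N lam Lam b) (hn : (n : ℕ) = 0)
    (m : SampleMask N L LF lam Lam b) :
    clippedGradientSum lam Lam C (markerModel.{u} LC LF C d) (markedDataset N j hs2) b θ m =
      (C * (s * sampledCount n {t | (t : ℕ) < LC + LF} m)) •
        EuclideanSpace.single d (1 : ℝ) := by
  have hclip : ∀ (i : Fin N) (t : Fin (numStarts L LF)),
      clip C ((markerModel.{u} LC LF C d).lossGradient θ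
        (subsequence LC LF (markedDataset N j hs2 i) t)) =
      if (i : ℕ) = 0 ∧ (t : ℕ) < LC + LF then
        (C * s) • EuclideanSpace.single d (1 : ℝ) else 0 := fun i t => by
    have hmarker := marker_subsequence_markedDataset (LC := LC) hj hs hs2 i t
    rw [clip_lossGradient_markerModel hC, hmarker]
    · split_ifs <;> simp
    · rw [hmarker]
      split_ifs
      · exact hs
      · simp
  simp only [clippedGradientSum, hclip]
  rw [Finset.sum_eq_single n]
  · simp only [hn, true_and, ← ite_and, ← Finset.sum_filter, Finset.sum_const]
    rw [← Nat.cast_smul_eq_nsmul ℝ, smul_smul, sampledCount, Finset.filter_filter]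
    simp only [and_comm]
    congr 1
    ring
  · intro i _ hi
    have hi0 : (i : ℕ) ≠ 0 := fun h => hi (Subtype.ext (Fin.ext (h.trans hn.symm)))
    simp [hi0]
  · simp

theorem map_stepLaw_markedDataset (hL : LC + LF ≤ numStarts L LF) (hLam : Lam ≠ 0) (hC : 0 < C)
    (hj : (j : ℕ) + 1 = LF) (hs : |s| ≤ 1) (hs2 : s < 2) (n : topLevelBatch N lam Lam b)
    (hn : (n : ℕ) = 0) :
    (stepLaw lam Lam σ C (markerModel.{u} LC LF C d) (markedDataset N j hs2) b θ).map
      (fun g => Lam / C * g d) =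
        binomialMoG (LC + LF) (samplingRate L LF lam) (fun k => s * k) σ := by
  have hLam' : (Lam : ℝ) ≠ 0 := Nat.cast_ne_zero.2 hLam
  have hcoord : (fun g : EuclideanSpace ℝ (Fin D) => (Lam : ℝ) / C * g d) ∘ ((C / Lam : ℝ) • ·) =
      inner ℝ (EuclideanSpace.single d (1 : ℝ)) := by
    funext g
    simp only [Function.comp_apply, EuclideanSpace.inner_single_left, PiLp.smul_apply, smul_eq_mul,
      map_one, one_mul]
    field_simp
  have hmean : ∀ m, inner ℝ (EuclideanSpace.single d (1 : ℝ)) (C⁻¹ • clippedGradientSum lam Lam C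
      (markerModel.{u} LC LF C d) (markedDataset N j hs2) b θ m) =
        s * sampledCount n {t | (t : ℕ) < LC + LF} m := fun m => by
    rw [clippedGradientSum_markedDataset hC hj hs hs2 n hn]
    simp [EuclideanSpace.inner_single_left, hC.ne']
  have hcard : ({t | (t : ℕ) < LC + LF} : Finset (Fin (numStarts L LF))).card = LC + LF := by
    rw [Fin.card_filter_val_lt, min_eq_right hL]
  rw [stepLaw_eq_map_gaussianMixture hC.ne', Measure.map_map (by fun_prop) (by fun_prop), hcoord,
    gaussianMixture_map_inner .of_discrete (by simp)]
  simp only [hmean]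
  refine gaussianMixture_eq_binomialMoG (μ := fun k => s * k) .of_discrete ?_
  rw [map_sampledCount_poissonSampling, hcard]

lemma eventNeighbor_markedDataset (hN : 0 < N) {s' : ℝ} (hs : s < 2) (hs' : s' < 2)
    (hne : s ≠ s') : EventNeighbor 1 (markedDataset N j hs) (markedDataset N j hs') := by
  refine ⟨⟨0, hN⟩, fun m hm => ?_, fun h => hne (Pi.single_injective j h), j, fun t ht => ?_⟩
  · have hm0 : (m : ℕ) ≠ 0 := fun h => hm (Fin.ext h)
    simp [markedDataset_apply, hm0]
  · obtain rfl : t = j := by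
      by_contra htj
      simp [markedDataset_apply, htj] at ht
    omega

lemma map_stepsLaw_markedDataset (hL : LC + LF ≤ numStarts L LF) (hlam : 0 < lam)
    (hLam : lam ≤ Lam) (hN : 0 < N) (hC : 0 < C) (hj : (j : ℕ) + 1 = LF) (hs : |s| ≤ 1)
    (hs2 : s < 2) (k : ℕ) :
    (stepsLaw lam Lam σ C η (markerModel.{u} LC LF C d) (markedDataset N j hs2) (k + 1) 0 θ).map
      (fun v => Lam / C * v 0 d) =
        binomialMoG (LC + LF) (samplingRate L LF lam) (fun k => s * k) σ := by
  have hbatch : (⟨0, hN⟩ : Fin N) ∈ topLevelBatch N lam Lam 0 := by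
    simp [topLevelBatch, Nat.div_pos hLam hlam]
  rw [← map_stepLaw_markedDataset hL (by omega) hC hj hs hs2 ⟨_, hbatch⟩ rfl (d := d),
    ← map_stepsLaw_eval_zero (k := k), Measure.map_map (by fun_prop) (by fun_prop)]
  rfl

theorem le_privacyProfile_markerModel (hLF : 1 ≤ LF) (hL : LC + LF ≤ numStarts L LF)
    (hlam : 1 ≤ lam) (hLam : lam ≤ Lam) (hN : Lam ≤ N * lam) (hσ : 0 < σ) (hC : 0 < C)
    (θ₀ : EuclideanSpace ℝ (Fin D)) (α : ℝ≥0) :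
    hockeyStick α (binomialMoG (LC + LF) (samplingRate L LF lam) (fun k => -(k : ℝ)) σ)
        (binomialMoG (LC + LF) (samplingRate L LF lam) (fun k => (k : ℝ)) σ) ≤
      privacyProfile (EventNeighbor 1) (fun x : Dataset N L =>
        epochMechanism lam Lam σ C η (markerModel.{u} LC LF C d) x θ₀) α := by
  have hN0 : 0 < N := Nat.pos_of_ne_zero fun h => by subst h; omega
  obtain ⟨k, hk⟩ : ∃ k, N * lam / Lam = k + 1 :=
    Nat.exists_eq_succ_of_ne_zero (Nat.div_pos hN (by omega)).ne'
  let j : Fin L := ⟨LF - 1, by unfold numStarts at hL; omega⟩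
  have hj : (j : ℕ) + 1 = LF := Nat.sub_add_cancel hLF
  have hneg := map_stepsLaw_markedDataset (N := N) (σ := σ) (η := η) (d := d) (θ := θ₀) hL hlam
    hLam hN0 hC hj (s := -1) (by simp) (by norm_num) k
  have hpos := map_stepsLaw_markedDataset (N := N) (σ := σ) (η := η) (d := d) (θ := θ₀) hL hlam
    hLam hN0 hC hj (s := 1) (by simp) (by norm_num) k
  have hprob := fun x : Dataset N L =>
    (stepsLaw_aux lam Lam σ C η (markerModel.{u} LC LF C d) x (k + 1) 0).2 θ₀
  simp only [neg_mul, one_mul] at hneg hpos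
  unfold epochMechanism
  rw [hk, ← hneg, ← hpos]
  refine (hockeyStick_map_le (stepsLaw_absolutelyContinuous hσ hC.ne') (by fun_prop)).trans ?_
  exact le_iSup₂_of_le _ _ (le_iSup_of_le
    (eventNeighbor_markedDataset (s := -1) (s' := 1) hN0 _ _ (by norm_num)) le_rfl)

end Tightness

end

theorem mainTheorem7
    (L LC LF N D lam Lam : ℕ) (σ : ℝ≥0) (C η : ℝ) (θ₀ : EuclideanSpace ℝ (Fin D))
    (hLF : 1 ≤ LF) (hL : LC + LF ≤ L + 1 - LF) (hD : 1 ≤ D)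
    (hlam : 1 ≤ lam) (hLam : lam ≤ Lam) (hN : Lam ≤ N * lam)
    (hσ : 0 < σ) (hC : 0 < C)
    (μ p : Fin (LC + LF + 1) → ℝ)
    (hμ : ∀ i, μ i = ((i : ℕ) : ℝ))
    (hp : ∀ i, p i = (binomial (LC + LF) (samplingRate L LF lam)).real {(i : ℕ)}) :
    (∀ f : ForecastModel.{u} D LC LF,
      IsDominatingPair (EventNeighbor 1)
        (fun x : Dataset N L => epochMechanism lam Lam σ C η f x θ₀)
        (MoG (fun i => -μ i) p σ) (MoG μ p σ)) ∧
    ∃ f : ForecastModel.{u} D LC LF,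
      IsTightDominatingPair (EventNeighbor 1)
        (fun x : Dataset N L => epochMechanism lam Lam σ C η f x θ₀)
        (MoG (fun i => -μ i) p σ) (MoG μ p σ) := by
  obtain rfl : μ = fun i : Fin (LC + LF + 1) => ((i : ℕ) : ℝ) := funext hμ
  obtain rfl : p = fun i : Fin (LC + LF + 1) =>
      (binomial (LC + LF) (samplingRate L LF lam)).real {(i : ℕ)} := funext hp
  have hprob : ∀ ν : ℕ → ℝ,
      IsProbabilityMeasure (binomialMoG (LC + LF) (samplingRate L LF lam) ν σ) :=
    fun _ => inferInstance
  exact ⟨fun f => ⟨hprob fun k => -k, hprob fun k => k,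
      privacyProfile_epochMechanism_le hL hσ hC θ₀⟩,
    markerModel LC LF C ⟨0, hD⟩, hprob fun k => -k, hprob fun k => k, fun α =>
      (privacyProfile_epochMechanism_le hL hσ hC θ₀ α).antisymm
        (le_privacyProfile_markerModel hLF hL hlam hLam hN hσ hC θ₀ α)⟩
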